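/- Let $N\ge 1$ relays $R_1,\dots,R_N$ assist the communication from a source $S$ to a destination $D$ (no direct link). Each of the $2N$ links $AB\in\{SR_b,R_bD : 1\le b\le N\}$ has fixed parameters $\alpha_{AB},\beta_{AB},\bar h_{AB},\rho_{AB}>0$ (two turbulence parameters, path loss, power fraction) and channel gain $h_{AB}=\bar h_{AB}\tilde h_{AB}$. The random variables $\tilde h_{AB}$ are mutually independent, and $\tilde h_{AB}$ has the Gamma-Gamma density $$f(x)=\frac{2(\alpha_{AB}\beta_{AB})^{(\alpha_{AB}+\beta_{AB})/2}}{\Gamma(\alpha_{AB})\Gamma(\beta_{AB})}\,x^{\frac{\alpha_{AB}+\beta_{AB}}{2}-1}K_{\alpha_{AB}-\beta_{AB}}\!\left(2\sqrt{\alpha_{AB}\beta_{AB}x}\right),\qquad x>0,$$ where $K_\nu$ is the modified Bessel function of the second kind. For system parameters $\eta,T_b,P_t,N_0,\gamma_{th}>0$, common to all links, let $$\gamma_{AB}=\frac{\eta^2\rho_{AB}^2T_b^2P_t^2h_{AB}^2}{N_0},\qquad P_M=\frac{\eta T_bP_t}{\sqrt{N_0\gamma_{th}}}$$ be the SNR of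 the link $AB$ and the power margin. Select-max relaying uses a relay $R_b$ with $b\in\operatorname{argmax}_i\min(\gamma_{SR_i},\gamma_{R_iD})$ (ties broken arbitrarily), and its outage probability is $P_{out}=\Pr\{\gamma_{SR_b}<\gamma_{th}\text{ or }\gamma_{R_bD}<\gamma_{th}\}$. Then, as $P_M\to\infty$ (in whatever way $\eta,T_b,P_t,N_0,\gamma_{th}$ vary), the diversity order exists and equals $$-\lim_{P_M\to\infty}\frac{\log P_{out}}{\log P_M}=\sum_{b=1}^N\min\left(q_{SR_b},q_{R_bD}\right),\qquad q_{AB}=\min(\alpha_{AB},\beta_{AB}).$$ -/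

import Mathlib

open MeasureTheory ProbabilityTheory Filter Topology

noncomputable section

/-- The modified Bessel function of the second kind `K_ν(z)`, for real order `ν` and real `z > 0`,
through its standard integral representation. -/
def besselK (ν z : ℝ) : ℝ :=
  ∫ t in Set.Ioi (0 : ℝ), Real.exp (-z * Real.cosh t) * Real.cosh (ν * t)

/-- The Gamma-Gamma density with parameters `α`, `β` (zero off the positive half-line). -/
def gammaGammaPDF (α β x : ℝ) : ℝ :=
  if 0 < x then
    2 * (α * β) ^ ((α + β) / 2) / (Real.Gamma α * Real.Gamma β) * x ^ ((α + β) / 2 - 1)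
      * besselK (α - β) (2 * Real.sqrt (α * β * x))
  else 0

/-- The Gamma-Gamma distribution on `ℝ`. -/
def gammaGammaMeasure (α β : ℝ) : Measure ℝ :=
  volume.withDensity fun x => ENNReal.ofReal (gammaGammaPDF α β x)

/-- The deterministic parameters of one optical link: the turbulence parameters `α`, `β`, the path
loss coefficient `hbar`, and the fraction `ρ` of the total optical power allocated to the link. -/
structure FSOLink where
  α : ℝ
  β : ℝ
  hbar : ℝ
  ρ : ℝ
  α_pos : 0 < α
  β_pos : 0 < β
  hbar_pos : 0 < hbar
  ρ_pos : 0 < ρ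

/-- `q = min(α, β)`. -/
def FSOLink.q (L : FSOLink) : ℝ := min L.α L.β

/-- The system parameters common to all links: responsivity `η`, slot duration `Tb`, total optical
power `Pt`, noise level `N0` and threshold SNR `γth`. -/
structure FSOBudget where
  η : ℝ
  Tb : ℝ
  Pt : ℝ
  N0 : ℝ
  γth : ℝ
  η_pos : 0 < η
  Tb_pos : 0 < Tb
  Pt_pos : 0 < Pt
  N0_pos : 0 < N0
  γth_pos : 0 < γth

/-- The power margin `P_M = η T_b P_t / √(N₀ γ_th)`. -/
def FSOBudget.powerMargin (s : FSOBudget) : ℝ :=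
  s.η * s.Tb * s.Pt / Real.sqrt (s.N0 * s.γth)

/-- The instantaneous SNR of a link whose turbulence-induced fading takes the value `x`; the
channel gain is `h = hbar * x`. -/
def FSOLink.snr (L : FSOLink) (s : FSOBudget) (x : ℝ) : ℝ :=
  s.η ^ 2 * L.ρ ^ 2 * s.Tb ^ 2 * s.Pt ^ 2 * (L.hbar * x) ^ 2 / s.N0

/-- The `min` equivalent SNR of an end-to-end path: source-relay link `A` with fading value `x`,
relay-destination link `B` with fading value `y`. -/
def minSNR (A B : FSOLink) (s : FSOBudget) (x y : ℝ) : ℝ :=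
  min (A.snr s x) (B.snr s y)

/-- `b` is a select-max relay choice: in every channel state, relay `b ω` has the largest `min`
equivalent SNR among all the relays (ties may be broken in any way). -/
def IsSelectMax {Ω : Type*} {N : ℕ} (SR RD : Fin N → FSOLink) (hSR hRD : Fin N → Ω → ℝ)
    (s : FSOBudget) (b : Ω → Fin N) : Prop :=
  ∀ ω i, minSNR (SR i) (RD i) s (hSR i ω) (hRD i ω)
    ≤ minSNR (SR (b ω)) (RD (b ω)) s (hSR (b ω) ω) (hRD (b ω) ω)

/-- The outage probability of threshold-based decode-and-forward relaying through the chosen relay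
`b ω`: the probability that the SNR of one of its two links is below the threshold. -/
def outageProb {Ω : Type*} [MeasurableSpace Ω] (μ : Measure Ω) {N : ℕ}
    (SR RD : Fin N → FSOLink) (hSR hRD : Fin N → Ω → ℝ) (s : FSOBudget) (b : Ω → Fin N) : ℝ :=
  μ.real {ω | (SR (b ω)).snr s (hSR (b ω) ω) < s.γth ∨ (RD (b ω)).snr s (hRD (b ω) ω) < s.γth}

/-- `G` is the diversity order of the outage probability `Pout`:
`- log Pout / log P_M → G` as `P_M → ∞`, however the system parameters bring this about. -/
def HasDiversityOrder (Pout : FSOBudget → ℝ) (G : ℝ) : Prop :=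
  Tendsto (fun s => -(Real.log (Pout s) / Real.log s.powerMargin))
    (comap FSOBudget.powerMargin atTop) (𝓝 G)

end

open MeasureTheory ProbabilityTheory Filter Topology

/-! A link is in outage exactly when its fading lies within `k / P_M` of zero, with `k` depending on
the link only, so the system parameters matter only through `P_M` (`FSOLink.snr_lt_iff`). Near zero
`K_ν(z)` grows like `z ^ (-|ν|)`, up to a logarithm when `ν = 0` (`le_besselK`, `besselK_le`). Hence
the density behaves like `x ^ (q - 1)` and the link outage probability like `P_M ^ (-q)`; an
arbitrarily small loss `ε` in the upper exponent absorbs the logarithm. Select-max fails iff every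
relay has a failing link (`outage_iff_forall`). By independence `P_out` is at most the product over
relays of the sum of the two link outage probabilities, and at least the product of those of each
relay's weaker link. Both products have order `∑ min(q, q)`, and the logarithmic ratio ignores
constants and every `ε` (`tendsto_neg_log_div_log`). -/

/-! ### Bounds for the Bessel function near zero -/

/-- Raise `w ≤ exp w` to the power `m` at `w = z * exp t / (2 * m)`. The resulting decay `exp (-m *
t)` beats `cosh (ν * t)` once `m > |ν|`. -/
theorem exp_neg_mul_cosh_le {m z : ℝ} (hm : 0 < m) (hz : 0 < z) (t : ℝ) :
    Real.exp (-z * Real.cosh t) ≤ (z / (2 * m)) ^ (-m) * Real.exp (-m * t) := by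
  have hy : z * Real.exp t / 2 ≤ z * Real.cosh t := by
    rw [Real.cosh_eq]
    nlinarith [Real.exp_pos (-t)]
  have hpow : (z / (2 * m) * Real.exp t) ^ m ≤ Real.exp (z * Real.exp t / 2) := by
    calc (z / (2 * m) * Real.exp t) ^ m
        ≤ Real.exp (z / (2 * m) * Real.exp t) ^ m := by
          refine Real.rpow_le_rpow (by positivity) ?_ hm.le
          linarith [Real.add_one_le_exp (z / (2 * m) * Real.exp t)]
      _ = Real.exp (z * Real.exp t / 2) := by
          rw [← Real.exp_mul]
          congr 1
          field_simp
  have hEq : (z / (2 * m)) ^ (-m) * Real.exp (-m * t) = ((z / (2 * m) * Real.exp t) ^ m)⁻¹ := by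
    rw [Real.mul_rpow (by positivity) (Real.exp_pos t).le, mul_inv, Real.rpow_neg (by positivity),
      ← Real.exp_mul, ← Real.exp_neg]
    congr 2
    ring
  rw [hEq, neg_mul, Real.exp_neg]
  gcongr
  exact hpow.trans (Real.exp_le_exp.mpr hy)

theorem cosh_mul_le_exp_abs_mul (ν : ℝ) {t : ℝ} (ht : 0 ≤ t) :
    Real.cosh (ν * t) ≤ Real.exp (|ν| * t) := by
  have h : |ν * t| = |ν| * t := by rw [abs_mul, abs_of_nonneg ht]
  rw [← Real.cosh_abs, h, Real.cosh_eq]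
  have : Real.exp (-(|ν| * t)) ≤ Real.exp (|ν| * t) :=
    Real.exp_le_exp.mpr (by nlinarith [mul_nonneg (abs_nonneg ν) ht])
  linarith

theorem exp_abs_mul_le_two_mul_cosh (ν : ℝ) {t : ℝ} (ht : 0 ≤ t) :
    Real.exp (|ν| * t) / 2 ≤ Real.cosh (ν * t) := by
  have h : |ν * t| = |ν| * t := by rw [abs_mul, abs_of_nonneg ht]
  rw [← Real.cosh_abs, h, Real.cosh_eq]
  linarith [Real.exp_pos (-(|ν| * t))]

theorem besselK_integrand_le {ν m z t : ℝ} (hm : |ν| < m) (hz : 0 < z) (ht : 0 ≤ t) :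
    Real.exp (-z * Real.cosh t) * Real.cosh (ν * t)
      ≤ (z / (2 * m)) ^ (-m) * Real.exp ((|ν| - m) * t) := by
  have hm0 : 0 < m := (abs_nonneg ν).trans_lt hm
  calc Real.exp (-z * Real.cosh t) * Real.cosh (ν * t)
      ≤ ((z / (2 * m)) ^ (-m) * Real.exp (-m * t)) * Real.exp (|ν| * t) := by
        gcongr
        · exact exp_neg_mul_cosh_le hm0 hz t
        · exact cosh_mul_le_exp_abs_mul ν ht
    _ = _ := by
        rw [mul_assoc, ← Real.exp_add]
        congr 2
        ring

theorem besselK_integrand_nonneg (ν z t : ℝ) :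
    0 ≤ Real.exp (-z * Real.cosh t) * Real.cosh (ν * t) :=
  mul_nonneg (Real.exp_pos _).le (Real.cosh_pos _).le

theorem integrableOn_besselK_integrand (ν : ℝ) {z : ℝ} (hz : 0 < z) :
    IntegrableOn (fun t => Real.exp (-z * Real.cosh t) * Real.cosh (ν * t)) (Set.Ioi 0) := by
  have hm : |ν| < |ν| + 1 := by linarith
  have hg : IntegrableOn (fun t => (z / (2 * (|ν| + 1))) ^ (-(|ν| + 1))
      * Real.exp ((|ν| - (|ν| + 1)) * t)) (Set.Ioi 0) :=
    (integrableOn_exp_mul_Ioi (by linarith) 0).const_mul _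
  refine Integrable.mono' hg (by fun_prop) ?_
  filter_upwards [ae_restrict_mem measurableSet_Ioi] with t ht
  rw [Real.norm_of_nonneg (besselK_integrand_nonneg ν z t)]
  exact besselK_integrand_le hm hz (le_of_lt ht)

theorem besselK_le {ν m z : ℝ} (hm : |ν| < m) (hz : 0 < z) :
    besselK ν z ≤ (2 * m) ^ m / (m - |ν|) * z ^ (-m) := by
  have hm0 : 0 < m := (abs_nonneg ν).trans_lt hm
  have hneg : |ν| - m < 0 := by linarith
  calc besselK ν z
      ≤ ∫ t in Set.Ioi (0 : ℝ), (z / (2 * m)) ^ (-m) * Real.exp ((|ν| - m) * t) :=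
        setIntegral_mono_on (integrableOn_besselK_integrand ν hz)
          ((integrableOn_exp_mul_Ioi hneg 0).const_mul _) measurableSet_Ioi
          fun t ht => besselK_integrand_le hm hz (le_of_lt ht)
    _ = (2 * m) ^ m / (m - |ν|) * z ^ (-m) := by
        rw [integral_const_mul, integral_exp_mul_Ioi hneg, Real.div_rpow hz.le (by positivity),
          Real.rpow_neg (by positivity : (0 : ℝ) ≤ 2 * m)]
        have : m - |ν| ≠ 0 := by linarith
        have : |ν| - m ≠ 0 := by linarith
        simp only [mul_zero, Real.exp_zero]
        field_simp
        ring

/-- A unit window starting at `T = -log z` suffices: there `z * cosh t ≤ e`, while `cosh (ν * t)`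
has already reached `z ^ (-|ν|) / 2`. -/
theorem le_besselK (ν : ℝ) {z : ℝ} (hz : 0 < z) (hz1 : z ≤ 1) :
    Real.exp (-Real.exp 1) / 2 * z ^ (-|ν|) ≤ besselK ν z := by
  set T : ℝ := -Real.log z with hT
  have hT0 : 0 ≤ T := by simpa [hT] using Real.log_nonpos hz.le hz1
  have hzT : z * Real.exp T = 1 := by
    rw [hT, Real.exp_neg, Real.exp_log hz, mul_inv_cancel₀ hz.ne']
  have hsub : Set.Ioc T (T + 1) ⊆ Set.Ioi (0 : ℝ) := fun t ht => hT0.trans_lt ht.1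
  have hint := integrableOn_besselK_integrand ν hz
  have hpt : ∀ t ∈ Set.Ioc T (T + 1), Real.exp (-Real.exp 1) / 2 * z ^ (-|ν|)
      ≤ Real.exp (-z * Real.cosh t) * Real.cosh (ν * t) := by
    intro t ht
    have ht0 : 0 ≤ t := hT0.trans ht.1.le
    have h1 : Real.exp (-Real.exp 1) ≤ Real.exp (-z * Real.cosh t) := by
      have hc : Real.cosh t ≤ Real.exp t := by
        simpa using cosh_mul_le_exp_abs_mul 1 ht0
      have he : Real.exp t ≤ Real.exp T * Real.exp 1 := by
        rw [← Real.exp_add]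
        exact Real.exp_le_exp.mpr ht.2
      have : z * Real.cosh t ≤ Real.exp 1 := by
        calc z * Real.cosh t ≤ z * (Real.exp T * Real.exp 1) := by gcongr; exact hc.trans he
          _ = Real.exp 1 := by rw [← mul_assoc, hzT, one_mul]
      apply Real.exp_le_exp.mpr
      linarith
    have h2 : z ^ (-|ν|) / 2 ≤ Real.cosh (ν * t) := by
      refine le_trans ?_ (exp_abs_mul_le_two_mul_cosh ν ht0)
      rw [Real.rpow_def_of_pos hz]
      have hle : Real.log z * -|ν| ≤ |ν| * t := by
        nlinarith [mul_le_mul_of_nonneg_left ht.1.le (abs_nonneg ν)]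
      linarith [Real.exp_le_exp.mpr hle]
    calc Real.exp (-Real.exp 1) / 2 * z ^ (-|ν|)
        = Real.exp (-Real.exp 1) * (z ^ (-|ν|) / 2) := by ring
      _ ≤ _ := by gcongr
  calc Real.exp (-Real.exp 1) / 2 * z ^ (-|ν|)
      = ∫ _ in Set.Ioc T (T + 1), Real.exp (-Real.exp 1) / 2 * z ^ (-|ν|) := by simp
    _ ≤ ∫ t in Set.Ioc T (T + 1), Real.exp (-z * Real.cosh t) * Real.cosh (ν * t) :=
        setIntegral_mono_on (integrableOn_const measure_Ioc_lt_top.ne) (hint.mono_set hsub)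
          measurableSet_Ioc hpt
    _ ≤ besselK ν z :=
        setIntegral_mono_set hint
          (ae_of_all _ fun t => besselK_integrand_nonneg ν z t) hsub.eventuallyLE

/-! ### The Gamma-Gamma law near zero -/

theorem half_add_sub_half_abs_sub (α β : ℝ) : (α + β) / 2 - |α - β| / 2 = min α β := by
  rcases le_total α β with h | h
  · rw [min_eq_left h, abs_of_nonpos (sub_nonpos.mpr h)]
    ring
  · rw [min_eq_right h, abs_of_nonneg (sub_nonneg.mpr h)]
    ring

theorem two_mul_sqrt_mul_rpow {a x : ℝ} (ha : 0 < a) (hx : 0 < x) (m : ℝ) :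
    (2 * Real.sqrt (a * x)) ^ m = (2 * Real.sqrt a) ^ m * x ^ (m / 2) := by
  rw [Real.sqrt_mul ha.le, ← mul_assoc, Real.mul_rpow (by positivity) (by positivity),
    Real.sqrt_eq_rpow x, ← Real.rpow_mul hx.le]
  congr 2
  ring

theorem exists_gammaGammaPDF_le {α β δ : ℝ} (hα : 0 < α) (hβ : 0 < β) (hδ : 0 < δ) :
    ∃ C > 0, ∀ x, 0 < x → gammaGammaPDF α β x ≤ C * x ^ (min α β - δ - 1) := by
  have hΓα := Real.Gamma_pos_of_pos hα
  have hΓβ := Real.Gamma_pos_of_pos hβ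
  -- The Bessel argument is of order `√x`, so an excess `2 * δ` here costs `δ` in the exponent of
  -- `x`.
  have hm : |α - β| < |α - β| + 2 * δ := by linarith
  have hab : 0 < α * β := mul_pos hα hβ
  refine ⟨2 * (α * β) ^ ((α + β) / 2) / (Real.Gamma α * Real.Gamma β)
    * ((2 * (|α - β| + 2 * δ)) ^ (|α - β| + 2 * δ) / (2 * δ)
      * (2 * Real.sqrt (α * β)) ^ (-(|α - β| + 2 * δ))), by positivity, fun x hx => ?_⟩
  have hK := besselK_le (ν := α - β) hm (z := 2 * Real.sqrt (α * β * x)) (by positivity)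
  rw [two_mul_sqrt_mul_rpow hab hx, add_sub_cancel_left] at hK
  have hexp : x ^ (min α β - δ - 1)
      = x ^ ((α + β) / 2 - 1) * x ^ (-(|α - β| + 2 * δ) / 2) := by
    rw [← Real.rpow_add hx, ← half_add_sub_half_abs_sub]
    congr 1
    ring
  rw [gammaGammaPDF, if_pos hx, hexp]
  refine (mul_le_mul_of_nonneg_left hK (by positivity)).trans_eq ?_
  ring

theorem exists_le_gammaGammaPDF {α β : ℝ} (hα : 0 < α) (hβ : 0 < β) :
    ∃ c > 0, ∃ u₀ > 0, ∀ x, 0 < x → x ≤ u₀ → c * x ^ (min α β - 1) ≤ gammaGammaPDF α β x := by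
  have hΓα := Real.Gamma_pos_of_pos hα
  have hΓβ := Real.Gamma_pos_of_pos hβ
  have hab : 0 < α * β := mul_pos hα hβ
  refine ⟨2 * (α * β) ^ ((α + β) / 2) / (Real.Gamma α * Real.Gamma β)
    * (Real.exp (-Real.exp 1) / 2 * (2 * Real.sqrt (α * β)) ^ (-|α - β|)), by positivity,
    -- This `u₀` keeps the Bessel argument at most `1`.
    1 / (4 * (α * β)), by positivity, fun x hx hxu => ?_⟩
  have hz1 : 2 * Real.sqrt (α * β * x) ≤ 1 := by
    have hle : α * β * x ≤ (1 / 2) ^ 2 := by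
      rw [le_div_iff₀ (by positivity)] at hxu
      nlinarith
    have := Real.sqrt_le_sqrt hle
    rw [Real.sqrt_sq (by norm_num)] at this
    linarith
  have hK := le_besselK (α - β) (z := 2 * Real.sqrt (α * β * x)) (by positivity) hz1
  rw [two_mul_sqrt_mul_rpow hab hx] at hK
  have hexp : x ^ (min α β - 1) = x ^ ((α + β) / 2 - 1) * x ^ (-|α - β| / 2) := by
    rw [← Real.rpow_add hx, ← half_add_sub_half_abs_sub]
    congr 1
    ring
  rw [gammaGammaPDF, if_pos hx, hexp]
  refine Eq.trans_le ?_ (mul_le_mul_of_nonneg_left hK (by positivity))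
  ring

theorem setLIntegral_Ioc_mul_rpow {C r u : ℝ} (hC : 0 < C) (hr : 0 < r) (hu : 0 < u) :
    ∫⁻ x in Set.Ioc 0 u, ENNReal.ofReal (C * x ^ (r - 1)) = ENNReal.ofReal (C / r * u ^ r) := by
  have hint : IntegrableOn (fun x : ℝ => C * x ^ (r - 1)) (Set.Ioc 0 u) :=
    ((intervalIntegrable_iff_integrableOn_Ioc_of_le hu.le).mp
      (intervalIntegral.intervalIntegrable_rpow' (by linarith))).const_mul C
  rw [← ofReal_integral_eq_lintegral_ofReal hint]
  · rw [← intervalIntegral.integral_of_le hu.le, intervalIntegral.integral_const_mul,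
      integral_rpow (Or.inl (by linarith)), sub_add_cancel, Real.zero_rpow hr.ne']
    congr 1
    ring
  · filter_upwards [ae_restrict_mem measurableSet_Ioc] with x hx
    have := hx.1
    positivity

theorem exists_gammaGammaMeasure_ball_le {α β δ : ℝ} (hα : 0 < α) (hβ : 0 < β) (hδ : 0 < δ) :
    ∃ C > 0, ∀ u, 0 < u → u ≤ 1 →
      gammaGammaMeasure α β (Metric.ball 0 u) ≤ ENNReal.ofReal (C * u ^ (min α β - δ)) := by
  have hq : 0 < min α β := lt_min hα hβ
  -- The cap keeps `min α β - ε` positive, so the power bound is integrable at zero.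
  set ε := min δ (min α β / 2) with hε
  have hε0 : 0 < ε := lt_min hδ (by linarith)
  have hεq : 0 < min α β - ε := by
    have : ε ≤ min α β / 2 := min_le_right _ _
    linarith
  obtain ⟨C, hC, hpdf⟩ := exists_gammaGammaPDF_le hα hβ hε0
  refine ⟨C / (min α β - ε), by positivity, fun u hu hu1 => ?_⟩
  rw [gammaGammaMeasure, withDensity_apply _ measurableSet_ball]
  calc ∫⁻ x in Metric.ball 0 u, ENNReal.ofReal (gammaGammaPDF α β x)
      ≤ ∫⁻ x in Metric.ball 0 u, (Set.Ioc 0 u).indicator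
          (fun x => ENNReal.ofReal (C * x ^ (min α β - ε - 1))) x := by
        refine setLIntegral_mono' measurableSet_ball fun x hx => ?_
        by_cases h0 : 0 < x
        · have hxu : x ≤ u := by
            rw [mem_ball_zero_iff, Real.norm_eq_abs] at hx
            exact (le_abs_self x).trans hx.le
          rw [Set.indicator_of_mem (show x ∈ Set.Ioc 0 u from ⟨h0, hxu⟩)]
          exact ENNReal.ofReal_le_ofReal (hpdf x h0)
        · simp [gammaGammaPDF, h0]
    _ ≤ ∫⁻ x, (Set.Ioc 0 u).indicator
          (fun x => ENNReal.ofReal (C * x ^ (min α β - ε - 1))) x := setLIntegral_le_lintegral _ _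
    _ = ENNReal.ofReal (C / (min α β - ε) * u ^ (min α β - ε)) := by
        rw [lintegral_indicator measurableSet_Ioc, setLIntegral_Ioc_mul_rpow hC hεq hu]
    _ ≤ _ := by
        refine ENNReal.ofReal_le_ofReal (mul_le_mul_of_nonneg_left ?_ (by positivity))
        refine Real.rpow_le_rpow_of_exponent_ge hu hu1 ?_
        have : ε ≤ δ := min_le_left _ _
        linarith

theorem exists_le_gammaGammaMeasure_ball {α β : ℝ} (hα : 0 < α) (hβ : 0 < β) :
    ∃ c > 0, ∃ u₀ > 0, ∀ u, 0 < u → u ≤ u₀ →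
      ENNReal.ofReal (c * u ^ min α β) ≤ gammaGammaMeasure α β (Metric.ball 0 u) := by
  have hq : 0 < min α β := lt_min hα hβ
  obtain ⟨c, hc, u₀, hu₀, hpdf⟩ := exists_le_gammaGammaPDF hα hβ
  refine ⟨c / min α β * (1 / 2) ^ min α β, by positivity, u₀, hu₀, fun u hu huu => ?_⟩
  rw [gammaGammaMeasure, withDensity_apply _ measurableSet_ball]
  have hhalf : 0 < u / 2 := by positivity
  calc ENNReal.ofReal (c / min α β * (1 / 2) ^ min α β * u ^ min α β)
      = ENNReal.ofReal (c / min α β * (u / 2) ^ min α β) := by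
        rw [mul_assoc, ← Real.mul_rpow (by positivity) hu.le]
        congr 3
        ring
    _ = ∫⁻ x in Set.Ioc 0 (u / 2), ENNReal.ofReal (c * x ^ (min α β - 1)) :=
        (setLIntegral_Ioc_mul_rpow hc hq hhalf).symm
    _ ≤ ∫⁻ x in Set.Ioc 0 (u / 2), ENNReal.ofReal (gammaGammaPDF α β x) :=
        setLIntegral_mono' measurableSet_Ioc fun x hx =>
          ENNReal.ofReal_le_ofReal (hpdf x hx.1 (by linarith [hx.2]))
    _ ≤ ∫⁻ x in Metric.ball 0 u, ENNReal.ofReal (gammaGammaPDF α β x) := by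
        refine lintegral_mono_set fun x hx => ?_
        rw [mem_ball_zero_iff, Real.norm_eq_abs, abs_of_pos hx.1]
        linarith [hx.2]

/-! ### Calculus of decay orders -/

/-- `f` decays no faster than `P ^ (-q)` along `l`. -/
def HasLowerOrder {S : Type*} (l : Filter S) (P f : S → ℝ) (q : ℝ) : Prop :=
  ∃ c > 0, ∀ᶠ s in l, c * P s ^ (-q) ≤ f s

/-- `f` decays at least as fast as `P ^ (ε - q)` along `l`, for every `ε > 0`. -/
def HasUpperOrder {S : Type*} (l : Filter S) (P f : S → ℝ) (q : ℝ) : Prop :=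
  ∀ ε > 0, ∃ C > 0, ∀ᶠ s in l, f s ≤ C * P s ^ (ε - q)

theorem HasLowerOrder.prod {S ι : Type*} [Fintype ι] {l : Filter S} {P : S → ℝ}
    {f : ι → S → ℝ} {q : ι → ℝ} (hP : Tendsto P l atTop)
    (h : ∀ i, HasLowerOrder l P (f i) (q i)) :
    HasLowerOrder l P (fun s => ∏ i, f i s) (∑ i, q i) := by
  choose c hc hf using h
  refine ⟨∏ i, c i, Finset.prod_pos fun i _ => hc i, ?_⟩
  filter_upwards [eventually_all.mpr hf, hP.eventually_gt_atTop 0] with s hs hPs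
  rw [← Finset.sum_neg_distrib, Real.rpow_sum_of_pos hPs, ← Finset.prod_mul_distrib]
  exact Finset.prod_le_prod
    (fun i _ => mul_nonneg (hc i).le (Real.rpow_nonneg hPs.le _)) fun i _ => hs i

theorem HasUpperOrder.prod {S ι : Type*} [Fintype ι] {l : Filter S} {P : S → ℝ}
    {f : ι → S → ℝ} {q : ι → ℝ} (hP : Tendsto P l atTop) (hf0 : ∀ i s, 0 ≤ f i s)
    (h : ∀ i, HasUpperOrder l P (f i) (q i)) :
    HasUpperOrder l P (fun s => ∏ i, f i s) (∑ i, q i) := by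
  intro ε hε
  -- The loss is shared among the factors; the `+ 1` covers an empty `ι`.
  have hε' : 0 < ε / (Fintype.card ι + 1) := by positivity
  choose C hC hf using fun i => h i _ hε'
  refine ⟨∏ i, C i, Finset.prod_pos fun i _ => hC i, ?_⟩
  filter_upwards [eventually_all.mpr hf, hP.eventually_ge_atTop 1] with s hs hPs
  calc ∏ i, f i s ≤ ∏ i, (C i * P s ^ (ε / (Fintype.card ι + 1) - q i)) :=
        Finset.prod_le_prod (fun i _ => hf0 i s) fun i _ => hs i
    _ = (∏ i, C i) * P s ^ (∑ i, (ε / (Fintype.card ι + 1) - q i)) := by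
        rw [Real.rpow_sum_of_pos (by linarith), Finset.prod_mul_distrib]
    _ ≤ (∏ i, C i) * P s ^ (ε - ∑ i, q i) := by
        refine mul_le_mul_of_nonneg_left (Real.rpow_le_rpow_of_exponent_le hPs ?_)
          (Finset.prod_nonneg fun i _ => (hC i).le)
        rw [Finset.sum_sub_distrib, Finset.sum_const, nsmul_eq_mul, Finset.card_univ]
        gcongr
        rw [mul_div_assoc', div_le_iff₀ (by positivity)]
        nlinarith

theorem HasUpperOrder.add {S : Type*} {l : Filter S} {P f g : S → ℝ} {p q : ℝ}
    (hP : Tendsto P l atTop) (hf : HasUpperOrder l P f p) (hg : HasUpperOrder l P g q) :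
    HasUpperOrder l P (fun s => f s + g s) (min p q) := by
  intro ε hε
  obtain ⟨C, hC, hf⟩ := hf ε hε
  obtain ⟨D, hD, hg⟩ := hg ε hε
  refine ⟨C + D, by positivity, ?_⟩
  filter_upwards [hf, hg, hP.eventually_ge_atTop 1] with s hfs hgs hPs
  rw [add_mul]
  refine add_le_add (hfs.trans ?_) (hgs.trans ?_)
  · exact mul_le_mul_of_nonneg_left (Real.rpow_le_rpow_of_exponent_le hPs
      (sub_le_sub_left (min_le_left _ _) ε)) hC.le
  · exact mul_le_mul_of_nonneg_left (Real.rpow_le_rpow_of_exponent_le hPs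
      (sub_le_sub_left (min_le_right _ _) ε)) hD.le

theorem tendsto_neg_log_div_log {S : Type*} {l : Filter S} {P f : S → ℝ} {q : ℝ}
    (hP : Tendsto P l atTop) (hlow : HasLowerOrder l P f q) (hup : HasUpperOrder l P f q) :
    Tendsto (fun s => -(Real.log (f s) / Real.log (P s))) l (𝓝 q) := by
  have hlog : Tendsto (fun s => Real.log (P s)) l atTop := Real.tendsto_log_atTop.comp hP
  have hzero (a : ℝ) : Tendsto (fun s => a / Real.log (P s)) l (𝓝 0) := hlog.const_div_atTop a
  obtain ⟨c, hc, hlow⟩ := hlow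
  rw [tendsto_order]
  constructor
  · intro a ha
    -- Half of the gap `q - a` pays for the loss in the exponent, the other half for `log C / log
    -- P`.
    obtain ⟨C, hC, hup⟩ := hup ((q - a) / 2) (by linarith)
    filter_upwards [hlow, hup, hP.eventually_gt_atTop 1,
      (hzero (Real.log C)).eventually (gt_mem_nhds (by linarith : (0 : ℝ) < (q - a) / 2))]
      with s h1 h2 h3 h4
    have hP0 : 0 < P s := by linarith
    have hL : 0 < Real.log (P s) := Real.log_pos h3
    have hf : 0 < f s := lt_of_lt_of_le (by positivity) h1
    have h5 := Real.log_le_log hf h2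
    rw [Real.log_mul hC.ne' (by positivity), Real.log_rpow hP0] at h5
    rw [div_lt_iff₀ hL] at h4
    rw [← neg_div, lt_div_iff₀ hL]
    nlinarith
  · intro a ha
    filter_upwards [hlow, hP.eventually_gt_atTop 1,
      (hzero (-Real.log c)).eventually (gt_mem_nhds (by linarith : (0 : ℝ) < a - q))]
      with s h1 h3 h4
    have hP0 : 0 < P s := by linarith
    have hL : 0 < Real.log (P s) := Real.log_pos h3
    have h5 := Real.log_le_log (by positivity) h1
    rw [Real.log_mul hc.ne' (by positivity), Real.log_rpow hP0] at h5
    rw [div_lt_iff₀ hL] at h4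
    rw [← neg_div, div_lt_iff₀ hL]
    nlinarith

/-! ### Outage of a single link -/

theorem FSOBudget.powerMargin_pos (s : FSOBudget) : 0 < s.powerMargin := by
  have := s.η_pos
  have := s.Tb_pos
  have := s.Pt_pos
  have := s.N0_pos
  have := s.γth_pos
  unfold FSOBudget.powerMargin
  positivity

/-- The event that a link is in outage is that its fading lies in a ball around zero, of radius
inversely proportional to the power margin. -/
theorem FSOLink.snr_lt_iff (L : FSOLink) (s : FSOBudget) (x : ℝ) :
    L.snr s x < s.γth ↔ x ∈ Metric.ball 0 ((L.ρ * L.hbar)⁻¹ * s.powerMargin⁻¹) := by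
  have := L.ρ_pos
  have := L.hbar_pos
  have hP := s.powerMargin_pos
  have hN := s.N0_pos
  have hγ := s.γth_pos
  have hsnr : L.snr s x = (L.ρ * L.hbar * s.powerMargin * x) ^ 2 * s.γth := by
    have hsq : Real.sqrt (s.N0 * s.γth) ^ 2 = s.N0 * s.γth := Real.sq_sqrt (by positivity)
    unfold FSOLink.snr FSOBudget.powerMargin
    rw [mul_pow (_ * _) x, mul_pow (_ * _) (_ / _), div_pow _ (Real.sqrt _), hsq]
    field_simp
  rw [hsnr, mul_lt_iff_lt_one_left hγ, sq_lt_one_iff_abs_lt_one, abs_mul,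
    abs_of_pos (by positivity), mem_ball_zero_iff, Real.norm_eq_abs, ← mul_inv,
    ← one_div, lt_div_iff₀ (by positivity), mul_comm]

theorem HasLaw.real_preimage_eq {Ω 𝓧 : Type*} [MeasurableSpace Ω] [MeasurableSpace 𝓧]
    {μ : Measure Ω} {ν : Measure 𝓧} {X : Ω → 𝓧} (h : HasLaw X ν μ) {t : Set 𝓧}
    (ht : MeasurableSet t) : μ.real (X ⁻¹' t) = ν.real t := by
  rw [← h.map_eq, measureReal_def, measureReal_def, Measure.map_apply_of_aemeasurable h.aemeasurable ht]

theorem FSOLink.hasLowerOrder_outage {Ω : Type*} [MeasurableSpace Ω] {μ : Measure Ω}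
    [IsProbabilityMeasure μ] (L : FSOLink) {X : Ω → ℝ}
    (hX : HasLaw X (gammaGammaMeasure L.α L.β) μ) :
    HasLowerOrder (comap FSOBudget.powerMargin atTop) FSOBudget.powerMargin
      (fun s => μ.real {ω | L.snr s (X ω) < s.γth}) L.q := by
  have hk : 0 < (L.ρ * L.hbar)⁻¹ := inv_pos.mpr (mul_pos L.ρ_pos L.hbar_pos)
  obtain ⟨c, hc, u₀, hu₀, h⟩ := exists_le_gammaGammaMeasure_ball L.α_pos L.β_pos
  refine ⟨c * (L.ρ * L.hbar)⁻¹ ^ L.q, by positivity, ?_⟩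
  have hsmall : Tendsto (fun s : FSOBudget => (L.ρ * L.hbar)⁻¹ * s.powerMargin⁻¹)
      (comap FSOBudget.powerMargin atTop) (𝓝 0) := by
    simpa using (tendsto_inv_atTop_zero.comp tendsto_comap).const_mul (L.ρ * L.hbar)⁻¹
  filter_upwards [hsmall.eventually (gt_mem_nhds hu₀)] with s hs
  have hP := s.powerMargin_pos
  have hprob : IsProbabilityMeasure (gammaGammaMeasure L.α L.β) := by
    rw [← hX.map_eq]
    exact Measure.isProbabilityMeasure_map hX.aemeasurable
  have hset : {ω | L.snr s (X ω) < s.γth}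
      = X ⁻¹' Metric.ball 0 ((L.ρ * L.hbar)⁻¹ * s.powerMargin⁻¹) := by
    ext ω
    exact L.snr_lt_iff s (X ω)
  rw [hset, HasLaw.real_preimage_eq hX measurableSet_ball, measureReal_def,
    ← ENNReal.ofReal_le_iff_le_toReal (measure_ne_top _ _), mul_assoc,
    Real.rpow_neg hP.le, ← Real.inv_rpow hP.le, ← Real.mul_rpow hk.le (by positivity)]
  exact h _ (by positivity) hs.le

theorem FSOLink.hasUpperOrder_outage {Ω : Type*} [MeasurableSpace Ω] {μ : Measure Ω}
    [IsProbabilityMeasure μ] (L : FSOLink) {X : Ω → ℝ}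
    (hX : HasLaw X (gammaGammaMeasure L.α L.β) μ) :
    HasUpperOrder (comap FSOBudget.powerMargin atTop) FSOBudget.powerMargin
      (fun s => μ.real {ω | L.snr s (X ω) < s.γth}) L.q := by
  intro ε hε
  have hk : 0 < (L.ρ * L.hbar)⁻¹ := inv_pos.mpr (mul_pos L.ρ_pos L.hbar_pos)
  obtain ⟨C, hC, h⟩ := exists_gammaGammaMeasure_ball_le L.α_pos L.β_pos hε
  refine ⟨C * (L.ρ * L.hbar)⁻¹ ^ (L.q - ε), by positivity, ?_⟩
  have hsmall : Tendsto (fun s : FSOBudget => (L.ρ * L.hbar)⁻¹ * s.powerMargin⁻¹)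
      (comap FSOBudget.powerMargin atTop) (𝓝 0) := by
    simpa using (tendsto_inv_atTop_zero.comp tendsto_comap).const_mul (L.ρ * L.hbar)⁻¹
  filter_upwards [hsmall.eventually (gt_mem_nhds one_pos)] with s hs
  have hP := s.powerMargin_pos
  have hset : {ω | L.snr s (X ω) < s.γth}
      = X ⁻¹' Metric.ball 0 ((L.ρ * L.hbar)⁻¹ * s.powerMargin⁻¹) := by
    ext ω
    exact L.snr_lt_iff s (X ω)
  rw [hset, HasLaw.real_preimage_eq hX measurableSet_ball, measureReal_def, mul_assoc,
    ← neg_sub L.q ε, Real.rpow_neg hP.le, ← Real.inv_rpow hP.le,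
    ← Real.mul_rpow hk.le (by positivity)]
  exact ENNReal.toReal_le_of_le_ofReal (by positivity) (h _ (by positivity) hs.le)

/-! ### Select-max outage, independence and the diversity order -/

theorem outage_iff_forall {Ω : Type*} {N : ℕ} {SR RD : Fin N → FSOLink} {hSR hRD : Fin N → Ω → ℝ}
    {s : FSOBudget} {b : Ω → Fin N} (hb : IsSelectMax SR RD hSR hRD s b) (ω : Ω) :
    ((SR (b ω)).snr s (hSR (b ω) ω) < s.γth ∨ (RD (b ω)).snr s (hRD (b ω) ω) < s.γth) ↔
      ∀ i, (SR i).snr s (hSR i ω) < s.γth ∨ (RD i).snr s (hRD i ω) < s.γth := by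
  refine ⟨fun h i => ?_, fun h => h (b ω)⟩
  rw [← min_lt_iff] at h ⊢
  exact (hb ω i).trans_lt h

section Independence

variable {Ω ι : Type*} [MeasurableSpace Ω] {μ : Measure Ω} [Fintype ι]
  {X Y : ι → Ω → ℝ} {A B : ι → Set ℝ}

/-- For independent families, the probability that for every `i` a chosen one of the two events
`X i ∈ A i` and `Y i ∈ B i` occurs is a product. -/
theorem real_iInter_cond_preimage_eq_prod (h : iIndepFun (Sum.elim X Y) μ)
    (hA : ∀ i, MeasurableSet (A i)) (hB : ∀ i, MeasurableSet (B i)) (σ : ι → Bool) :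
    μ.real (⋂ i, cond (σ i) (X i ⁻¹' A i) (Y i ⁻¹' B i))
      = ∏ i, cond (σ i) (μ.real (X i ⁻¹' A i)) (μ.real (Y i ⁻¹' B i)) := by
  have hinj : Function.Injective fun i => cond (σ i) (Sum.inl i : ι ⊕ ι) (Sum.inr i) := by
    intro i j hij
    cases hi : σ i <;> cases hj : σ j <;> simp_all
  have key := (h.precomp hinj).measure_inter_preimage_eq_mul Finset.univ
    (sets := fun i => cond (σ i) (A i) (B i)) fun i _ => by cases σ i <;> simp [hA, hB]
  have hset (i : ι) : Sum.elim X Y (cond (σ i) (Sum.inl i) (Sum.inr i)) ⁻¹' cond (σ i) (A i) (B i)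
      = cond (σ i) (X i ⁻¹' A i) (Y i ⁻¹' B i) := by
    cases σ i <;> rfl
  simp only [hset, Finset.mem_univ, Set.iInter_true] at key
  rw [measureReal_def, key, ENNReal.toReal_prod]
  refine Finset.prod_congr rfl fun i _ => ?_
  cases σ i <;> rfl

/-- Choosing one occurring event per index covers the intersection by `2 ^ |ι|` events of product
probability; their sum is the expanded right-hand side. -/
theorem real_iInter_union_preimage_le_prod [IsProbabilityMeasure μ]
    (h : iIndepFun (Sum.elim X Y) μ)
    (hA : ∀ i, MeasurableSet (A i)) (hB : ∀ i, MeasurableSet (B i)) :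
    μ.real (⋂ i, (X i ⁻¹' A i ∪ Y i ⁻¹' B i))
      ≤ ∏ i, (μ.real (X i ⁻¹' A i) + μ.real (Y i ⁻¹' B i)) := by
  classical
  have hsub : (⋂ i, (X i ⁻¹' A i ∪ Y i ⁻¹' B i))
      ⊆ ⋃ σ : ι → Bool, ⋂ i, cond (σ i) (X i ⁻¹' A i) (Y i ⁻¹' B i) := by
    intro ω hω
    rw [Set.mem_iInter] at hω
    refine Set.mem_iUnion.mpr ⟨fun i => decide (ω ∈ X i ⁻¹' A i), Set.mem_iInter.mpr fun i => ?_⟩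
    by_cases hi : ω ∈ X i ⁻¹' A i
    · simp [hi]
    · simpa [hi] using (hω i).resolve_left hi
  calc μ.real (⋂ i, (X i ⁻¹' A i ∪ Y i ⁻¹' B i))
      ≤ μ.real (⋃ σ : ι → Bool, ⋂ i, cond (σ i) (X i ⁻¹' A i) (Y i ⁻¹' B i)) :=
        measureReal_mono hsub
    _ ≤ ∑ σ : ι → Bool, μ.real (⋂ i, cond (σ i) (X i ⁻¹' A i) (Y i ⁻¹' B i)) :=
        measureReal_iUnion_fintype_le _
    _ = ∑ σ : ι → Bool, ∏ i, cond (σ i) (μ.real (X i ⁻¹' A i)) (μ.real (Y i ⁻¹' B i)) :=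
        Finset.sum_congr rfl fun σ _ => real_iInter_cond_preimage_eq_prod h hA hB σ
    _ = ∏ i, ∑ c : Bool, cond c (μ.real (X i ⁻¹' A i)) (μ.real (Y i ⁻¹' B i)) :=
        (Fintype.prod_sum fun i c => cond c (μ.real (X i ⁻¹' A i)) (μ.real (Y i ⁻¹' B i))).symm
    _ = _ := by simp

end Independence

/-- The right-hand side is free of `b`, so neither tie-breaking nor measurability of the choice
matters. -/
theorem outageProb_eq {Ω : Type*} [MeasurableSpace Ω] (μ : Measure Ω) {N : ℕ}
    {SR RD : Fin N → FSOLink} {hSR hRD : Fin N → Ω → ℝ} {s : FSOBudget} {b : Ω → Fin N}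
    (hb : IsSelectMax SR RD hSR hRD s b) :
    outageProb μ SR RD hSR hRD s b
      = μ.real (⋂ i, (hSR i ⁻¹' {x | (SR i).snr s x < s.γth}
          ∪ hRD i ⁻¹' {x | (RD i).snr s x < s.γth})) := by
  unfold outageProb
  congr 1
  ext ω
  simp only [Set.mem_iInter, Set.mem_union, Set.mem_preimage, Set.mem_ofPred_eq]
  exact outage_iff_forall hb ω

theorem FSOLink.measurableSet_snr_lt (L : FSOLink) (s : FSOBudget) :
    MeasurableSet {x | L.snr s x < s.γth} := by
  simp only [L.snr_lt_iff s, Set.ofPred_mem_eq]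
  exact measurableSet_ball

theorem corollary2 {Ω : Type*} [MeasurableSpace Ω] (μ : Measure Ω) [IsProbabilityMeasure μ]
    (N : ℕ) (hN : 1 ≤ N) (SR RD : Fin N → FSOLink) (hSR hRD : Fin N → Ω → ℝ)
    (lawSR : ∀ i, HasLaw (hSR i) (gammaGammaMeasure (SR i).α (SR i).β) μ)
    (lawRD : ∀ i, HasLaw (hRD i) (gammaGammaMeasure (RD i).α (RD i).β) μ)
    (indep : iIndepFun (Sum.elim hSR hRD) μ)
    (b : FSOBudget → Ω → Fin N) (hb : ∀ s, IsSelectMax SR RD hSR hRD s (b s)) :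
    HasDiversityOrder (fun s => outageProb μ SR RD hSR hRD s (b s))
      (∑ i, min (SR i).q (RD i).q) := by
  refine tendsto_neg_log_div_log tendsto_comap ?_ ?_
  -- `σ` picks in each relay the link with smaller `q`; joint failure of the picked links already
  -- forces outage.
  · set σ : Fin N → Bool := fun i => decide ((SR i).q ≤ (RD i).q) with hσ
    have hlow (i : Fin N) : HasLowerOrder (comap FSOBudget.powerMargin atTop)
        FSOBudget.powerMargin (fun s => cond (σ i)
          (μ.real (hSR i ⁻¹' {x | (SR i).snr s x < s.γth}))
          (μ.real (hRD i ⁻¹' {x | (RD i).snr s x < s.γth}))) (min (SR i).q (RD i).q) := by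
      by_cases hi : (SR i).q ≤ (RD i).q
      · simpa [hσ, hi] using (SR i).hasLowerOrder_outage (lawSR i)
      · simpa [hσ, hi, min_eq_right (le_of_not_ge hi)] using (RD i).hasLowerOrder_outage (lawRD i)
    obtain ⟨c, hc, hprod⟩ := HasLowerOrder.prod tendsto_comap hlow
    refine ⟨c, hc, hprod.mono fun s hs => hs.trans ?_⟩
    beta_reduce
    rw [outageProb_eq μ (hb s), ← real_iInter_cond_preimage_eq_prod indep
      (fun i => (SR i).measurableSet_snr_lt s) (fun i => (RD i).measurableSet_snr_lt s) σ]
    refine measureReal_mono (Set.iInter_mono fun i => ?_)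
    cases σ i
    · exact Set.subset_union_right
    · exact Set.subset_union_left
  · intro ε hε
    obtain ⟨C, hC, hprod⟩ := HasUpperOrder.prod tendsto_comap
      (fun i s => add_nonneg measureReal_nonneg measureReal_nonneg)
      (fun i => ((SR i).hasUpperOrder_outage (lawSR i)).add tendsto_comap
        ((RD i).hasUpperOrder_outage (lawRD i))) ε hε
    refine ⟨C, hC, hprod.mono fun s hs => le_trans ?_ hs⟩
    beta_reduce
    rw [outageProb_eq μ (hb s)]
    exact real_iInter_union_preimage_le_prod indep
      (fun i => (SR i).measurableSet_snr_lt s) (fun i => (RD i).measurableSet_snr_lt s)
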